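/- Let $K$ be a compact Hausdorff space and let $d$ be a metric on the set $K$ which is lower semicontinuous as a function $d\colon K\times K\to[0,\infty)$, where $K \times K$ carries the product topology. Let $C(K)$ be the Banach space of continuous real functions on $K$ with the supremum norm, let $\mathrm{Lip}(K)$ be the set of real functions on $K$ that are Lipschitz with respect to $d$, and call a closed linear subspace $X$ of $C(K)$ a Lipschitz subspace if $X\subset \mathrm{Lip}(K)$. Then $d$ metrizes $K$ (that is, the topology generated by $d$ is the topology of $K$) if and only if every Lipschitz subspace of $C(K)$ is finite-dimensional. Equivalently, $\mathrm{Lip}(K)\cap C(K)$ is spaceable in $C(K)$, that is, contains an infinite-dimensional closed linear subspace of $C(K)$, if and only if $d$ does not metrize $K$. -/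

import Mathlib

namespace LipSubspace

/-- `d : K × K → [0, ∞)` is a metric on the set `K`. No relation with any topology of `K` is
required here. -/
structure IsMetric {K : Type*} (d : K → K → ℝ) : Prop where
  nonneg : ∀ x y, 0 ≤ d x y
  eq_zero_iff : ∀ x y, d x y = 0 ↔ x = y
  symm : ∀ x y, d x y = d y x
  triangle : ∀ x y z, d x z ≤ d x y + d y z

/-- The metric `d` is lower semicontinuous as a function on `K × K`, for the product of the
given topology of `K` with itself. -/
def IsLscMetric {K : Type*} [TopologicalSpace K] (d : K → K → ℝ) : Prop :=
  IsMetric d ∧ LowerSemicontinuous (fun p : K × K => d p.1 p.2)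

/-- `d` metrizes `K`: the open sets of the given topology of `K` are exactly the open sets of the
topology generated by `d`, i.e. the sets containing a `d`-ball around each of their points. -/
def Metrizes {K : Type*} [TopologicalSpace K] (d : K → K → ℝ) : Prop :=
  ∀ U : Set K, IsOpen U ↔ ∀ x ∈ U, ∃ ε > 0, ∀ y, d x y < ε → y ∈ U

/-- The real function `f` is Lipschitz with respect to `d`. -/
def IsLip {K : Type*} (d : K → K → ℝ) (f : K → ℝ) : Prop :=
  ∃ C : ℝ, ∀ s t : K, |f s - f t| ≤ C * d s t

/-- `Lip(K) ∩ C(K)`: the linear subspace of `C(K)` consisting of the `d`-Lipschitz functions. -/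
def lipC {K : Type*} [TopologicalSpace K] (d : K → K → ℝ) : Submodule ℝ C(K, ℝ) where
  carrier := {f | IsLip d f}
  zero_mem' := ⟨0, fun s t => by simp⟩
  add_mem' := by
    rintro f g ⟨C, hC⟩ ⟨D, hD⟩
    refine ⟨C + D, fun s t => ?_⟩
    have h : (f + g) s - (f + g) t = (f s - f t) + (g s - g t) := by
      simp only [ContinuousMap.add_apply]; ring
    rw [h, add_mul]
    exact (abs_add_le _ _).trans (add_le_add (hC s t) (hD s t))
  smul_mem' := by
    rintro c f ⟨C, hC⟩
    refine ⟨|c| * C, fun s t => ?_⟩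
    have h : (c • f) s - (c • f) t = c * (f s - f t) := by
      simp only [ContinuousMap.smul_apply, smul_eq_mul]; ring
    rw [h, abs_mul, mul_assoc]
    exact mul_le_mul_of_nonneg_left (hC s t) (abs_nonneg c)

/-- A Lipschitz subspace of `C(K)`: a subspace (closed for the supremum norm, i.e. a Banach
subspace) all of whose elements are Lipschitz with respect to `d`. -/
structure IsLipschitzSubspace {K : Type*} [TopologicalSpace K] [CompactSpace K]
    (d : K → K → ℝ) (X : Submodule ℝ C(K, ℝ)) : Prop where
  isClosed : IsClosed (X : Set C(K, ℝ))
  isLip : ∀ f ∈ X, IsLip d f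

/-- A linear subspace `A` of a real normed space `E` is spaceable if it contains an
infinite-dimensional closed subspace of `E`. -/
def IsSpaceable {E : Type*} [NormedAddCommGroup E] [NormedSpace ℝ E]
    (A : Submodule ℝ E) : Prop :=
  ∃ X : Submodule ℝ E, X ≤ A ∧ IsClosed (X : Set E) ∧ ¬ FiniteDimensional ℝ X

end LipSubspace

/-
If `d` metrizes `K`, the uniform boundedness principle applied to the functionals
`f ↦ (f s - f t) / d s t` makes the unit ball of a Lipschitz subspace uniformly Lipschitz, hence
equicontinuous, and Arzelà–Ascoli together with Riesz's theorem gives finite dimension.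

If not, there is a point `p` all of whose neighbourhoods contain points at distance `≥ ε` from `p`.
Continuous `1`-Lipschitz functions separating `p` from such points yield infinitely many disjointly
supported continuous `1`-Lipschitz functions of norm bounded below, and their closed span is a
Lipschitz subspace isomorphic to `c₀`.

The separating functions come from order: lower semicontinuity of `d` says precisely that
`(s, a) ≤ (t, b) ↔ d s t ≤ b - a` is a closed preorder on the compact space `K × [0, r]`. Nachbin's
monotone version of Urysohn's lemma gives a continuous monotone `F : K × [0, r] → [0, 1]`, and the
average height `s ↦ ∫ a in 0..r, (1 - F (s, a))` is then continuous and `1`-Lipschitz.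
-/

open Set Filter Topology Function

namespace LipSubspace

section MonotoneUrysohn

variable {α : Type*} [TopologicalSpace α] [Preorder α]

lemma isClosed_upperClosure_of_compactSpace [CompactSpace α] [OrderClosedTopology α] {s : Set α}
    (hs : IsClosed s) : IsClosed (upperClosure s : Set α) := by
  convert isClosedMap_snd_of_compactSpace _
    (OrderClosedTopology.isClosed_le'.inter (hs.preimage continuous_fst)) using 1
  ext x
  simp [and_comm]

lemma isClosed_lowerClosure_of_compactSpace [CompactSpace α] [OrderClosedTopology α] {s : Set α}
    (hs : IsClosed s) : IsClosed (lowerClosure s : Set α) :=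
  have : CompactSpace αᵒᵈ := ‹CompactSpace α›
  isClosed_upperClosure_of_compactSpace (α := αᵒᵈ) hs

lemma exists_isOpen_isLowerSet_closure_subset [CompactSpace α] [NormalSpace α]
    [OrderClosedTopology α] {s u : Set α} (hs : IsClosed s) (hu : IsOpen u) (hul : IsLowerSet u)
    (hsu : s ⊆ u) : ∃ v, IsOpen v ∧ IsLowerSet v ∧ s ⊆ v ∧ closure v ⊆ u := by
  obtain ⟨w, hw, hsw, hwu⟩ := normal_exists_closure_subset
    (isClosed_lowerClosure_of_compactSpace hs) hu (lowerClosure_min hsu hul)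
  have hvw : (upperClosure wᶜ : Set α)ᶜ ⊆ w := compl_subset_comm.1 subset_upperClosure
  refine ⟨(upperClosure wᶜ : Set α)ᶜ,
    (isClosed_upperClosure_of_compactSpace hw.isClosed_compl).isOpen_compl,
    (upperClosure wᶜ).upper.compl, ?_, (closure_mono hvw).trans hwu⟩
  rintro x hx ⟨y, hy, hyx⟩
  exact hy (hsw ⟨x, hx, hyx⟩)

lemma monotone_urysohn_approx {P : Set α → Set α → Prop} (hP : ∀ c u, P c u → IsLowerSet u)
    (c : Urysohns.CU P) (n : ℕ) : Monotone (c.approx n) := by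
  intro x y hxy
  induction n generalizing c with
  | zero =>
    by_cases hx : x ∈ c.U
    · rw [Urysohns.CU.approx, indicator_of_notMem (notMem_compl_iff.2 hx)]
      exact c.approx_nonneg 0 y
    · rw [c.approx_of_notMem_U 0 fun hy => hx (hP _ _ c.P_C_U hxy hy)]
      exact c.approx_le_one 0 x
  | succ n ih => exact midpoint_le_midpoint (ih c.left) (ih c.right)

theorem exists_continuous_monotone_zero_one [CompactSpace α] [NormalSpace α]
    [OrderClosedTopology α] {s t : Set α} (hs : IsClosed s) (ht : IsClosed t)
    (hst : ∀ x ∈ s, ∀ y ∈ t, ¬ y ≤ x) :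
    ∃ F : C(α, ℝ), Monotone F ∧ EqOn F 0 s ∧ EqOn F 1 t ∧ ∀ x, F x ∈ Icc (0 : ℝ) 1 := by
  let c : Urysohns.CU fun _ u : Set α => IsLowerSet u :=
    { C := s
      U := (upperClosure t : Set α)ᶜ
      P_C_U := (upperClosure t).upper.compl
      closed_C := hs
      open_U := (isClosed_upperClosure_of_compactSpace ht).isOpen_compl
      subset := fun x hx ⟨y, hy, hyx⟩ => hst x hx y hy hyx
      hP := fun hc hul hu hcu => by
        obtain ⟨v, hv, hvl, hcv, hvu⟩ := exists_isOpen_isLowerSet_closure_subset hc hu hul hcu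
        exact ⟨v, hv, hcv, hvu, hvl, hul⟩ }
  have hmono : Monotone c.lim := fun x y hxy =>
    ciSup_mono (c.bddAbove_range_approx y) fun n => monotone_urysohn_approx (fun _ _ h => h) c n hxy
  exact ⟨⟨c.lim, c.continuous_lim⟩, hmono, c.lim_of_mem_C,
    fun x hx => c.lim_of_notMem_U x (notMem_compl_iff.2 (subset_upperClosure hx)), c.lim_mem_Icc⟩

end MonotoneUrysohn

section Separation

lemma integral_le_integral_add_of_shift_le {u v : ℝ → ℝ} (hu : Continuous u) (hv : Continuous v)
    (hu1 : ∀ a, u a ≤ 1) (hv0 : ∀ a, 0 ≤ v a) {r δ : ℝ} (hr : 0 ≤ r) (hδ : 0 ≤ δ)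
    (huv : ∀ a ∈ Icc 0 (r - δ), u (a + δ) ≤ v a) :
    ∫ a in 0..r, u a ≤ (∫ a in 0..r, v a) + δ := by
  have hu_le : ∀ b, 0 ≤ b → ∫ a in 0..b, u a ≤ b := fun b hb => by
    simpa using intervalIntegral.integral_mono_on (μ := MeasureTheory.volume) hb
      (hu.intervalIntegrable 0 b) (intervalIntegrable_const (c := (1 : ℝ))) fun a _ => hu1 a
  have hv_nonneg : ∀ b c, b ≤ c → 0 ≤ ∫ a in b..c, v a := fun b c hbc =>
    intervalIntegral.integral_nonneg hbc fun a _ => hv0 a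
  rcases le_total δ r with hδr | hrδ
  · calc ∫ a in 0..r, u a
        = (∫ a in 0..δ, u a) + ∫ a in δ..r, u a :=
          (intervalIntegral.integral_add_adjacent_intervals (hu.intervalIntegrable _ _)
            (hu.intervalIntegrable _ _)).symm
      _ = (∫ a in 0..δ, u a) + ∫ a in 0..(r - δ), u (a + δ) := by
          rw [intervalIntegral.integral_comp_add_right u, zero_add, sub_add_cancel]
      _ ≤ δ + ∫ a in 0..(r - δ), v a := by
          refine add_le_add (hu_le δ hδ) (intervalIntegral.integral_mono_on (sub_nonneg.2 hδr) ?_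
            (hv.intervalIntegrable _ _) huv)
          exact (hu.comp (continuous_id.add continuous_const)).intervalIntegrable _ _
      _ ≤ δ + ∫ a in 0..r, v a := by
          rw [← intervalIntegral.integral_add_adjacent_intervals
            (hv.intervalIntegrable 0 (r - δ)) (hv.intervalIntegrable (r - δ) r)]
          linarith [hv_nonneg (r - δ) r (sub_le_self r hδ)]
      _ = (∫ a in 0..r, v a) + δ := add_comm _ _
  · linarith [hu_le r hr, hv_nonneg 0 r hr]

variable {K : Type*} {d : K → K → ℝ}

lemma IsMetric.self_eq_zero (hd : IsMetric d) (x : K) : d x x = 0 :=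
  (hd.eq_zero_iff x x).2 rfl

/-- The preorder on `K × [0, r]` for which a function `f : K → [0, r]` is `1`-Lipschitz exactly
when its epigraph is an upper set. -/
abbrev IsMetric.epigraphPreorder (hd : IsMetric d) (r : ℝ) : Preorder (K × Icc (0 : ℝ) r) where
  le z w := d z.1 w.1 ≤ w.2 - z.2
  le_refl z := by rw [hd.self_eq_zero, sub_self]
  le_trans z w v hzw hwv := by linarith [hd.triangle z.1 w.1 v.1]

variable [TopologicalSpace K]

lemma IsLscMetric.orderClosedTopology_epigraphPreorder (hd : IsLscMetric d) (r : ℝ) :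
    @OrderClosedTopology (K × Icc (0 : ℝ) r) _ (hd.1.epigraphPreorder r) :=
  letI := hd.1.epigraphPreorder r
  ⟨hd.2.isClosed_epigraph.preimage (f := fun z : (K × Icc (0 : ℝ) r) × (K × Icc (0 : ℝ) r) =>
    ((z.1.1, z.2.1), (z.2.2 : ℝ) - z.1.2)) (by fun_prop)⟩

lemma IsMetric.abs_integral_sub_integral_le (hd : IsMetric d) {r : ℝ} (hr : 0 ≤ r)
    {F : C(K × Icc (0 : ℝ) r, ℝ)}
    (hF : ∀ z w : K × Icc (0 : ℝ) r, d z.1 w.1 ≤ w.2 - z.2 → F z ≤ F w)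
    (hF01 : ∀ z, F z ∈ Icc (0 : ℝ) 1) (s t : K) :
    |(∫ a in 0..r, (1 - F (s, projIcc 0 r hr a))) - ∫ a in 0..r, (1 - F (t, projIcc 0 r hr a))| ≤
      d s t := by
  have hcont : ∀ s, Continuous fun a => 1 - F (s, projIcc 0 r hr a) := fun s => by fun_prop
  have hle : ∀ s t, ∫ a in 0..r, (1 - F (t, projIcc 0 r hr a)) ≤
      (∫ a in 0..r, (1 - F (s, projIcc 0 r hr a))) + d s t := fun s t => by
    refine integral_le_integral_add_of_shift_le (hcont t) (hcont s)
      (fun a => sub_le_self _ (hF01 _).1) (fun a => sub_nonneg.2 (hF01 _).2) hr (hd.nonneg s t)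
      fun a ha => sub_le_sub_left (hF _ _ ?_) 1
    rw [projIcc_of_mem hr ⟨ha.1, by linarith [ha.2, hd.nonneg s t]⟩,
      projIcc_of_mem hr ⟨by linarith [ha.1, hd.nonneg s t], by linarith [ha.2]⟩]
    exact (add_sub_cancel_left a (d s t)).ge
  rw [abs_sub_le_iff, sub_le_iff_le_add', sub_le_iff_le_add']
  exact ⟨hd.symm s t ▸ hle t s, hle s t⟩

theorem IsLscMetric.exists_separating [CompactSpace K] [T2Space K] (hd : IsLscMetric d)
    {A B : Set K} (hA : IsClosed A) (hB : IsClosed B) {r : ℝ} (hr : 0 ≤ r)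
    (hAB : ∀ a ∈ A, ∀ b ∈ B, r < d a b) :
    ∃ f : C(K, ℝ), (∀ s t, |f s - f t| ≤ d s t) ∧ (∀ a ∈ A, f a = 0) ∧ ∀ b ∈ B, f b = r := by
  let := hd.1.epigraphPreorder r
  have := hd.orderClosedTopology_epigraphPreorder r
  obtain ⟨F, hmono, hF0, hF1, hF01⟩ := exists_continuous_monotone_zero_one
    (hB.prod (isClosed_singleton (x := (⟨r, hr, le_rfl⟩ : Icc (0 : ℝ) r))))
    (hA.prod (isClosed_singleton (x := (⟨0, le_rfl, hr⟩ : Icc (0 : ℝ) r)))) (by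
      rintro ⟨b, _⟩ ⟨hb, rfl⟩ ⟨a, _⟩ ⟨ha, rfl⟩ (hle : d a b ≤ r - 0)
      exact (hAB a ha b hb).not_ge (by rwa [sub_zero] at hle))
  have hFA : ∀ a ∈ A, ∀ h, F (a, h) = 1 := fun a ha h => by
    refine le_antisymm (hF01 _).2 ((hF1 (x := (a, ⟨0, le_rfl, hr⟩)) ⟨ha, rfl⟩).ge.trans (hmono ?_))
    change d a a ≤ h - 0
    simpa only [hd.1.self_eq_zero, sub_zero] using h.2.1
  have hFB : ∀ b ∈ B, ∀ h, F (b, h) = 0 := fun b hb h => by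
    refine le_antisymm ((hmono ?_).trans (hF0 (x := (b, ⟨r, hr, le_rfl⟩)) ⟨hb, rfl⟩).le) (hF01 _).1
    change d b b ≤ r - h
    simpa only [hd.1.self_eq_zero, sub_nonneg] using h.2.2
  refine ⟨⟨fun s => ∫ a in 0..r, (1 - F (s, projIcc 0 r hr a)), ?_⟩,
    hd.1.abs_integral_sub_integral_le hr (fun z w h => hmono h) hF01, fun a ha => ?_,
    fun b hb => ?_⟩
  · exact intervalIntegral.continuous_parametric_intervalIntegral_of_continuous' (by fun_prop) 0 r
  · simp [hFA a ha]
  · simp [hFB b hb]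

end Separation

section DisjointSupports

variable {ι K : Type*} {d : K → K → ℝ}

lemma sum_abs_sub_le_of_disjoint_support {f : ι → K → ℝ}
    (hf : Pairwise (Disjoint on fun i => support (f i))) {s t : K} {δ : ℝ} (hδ : 0 ≤ δ)
    (hfδ : ∀ i, |f i s - f i t| ≤ δ) (S : Finset ι) : ∑ i ∈ S, |f i s - f i t| ≤ 2 * δ := by
  classical
  have hcard : ∀ x, {i ∈ S | f i x ≠ 0}.card ≤ 1 := fun x => Finset.card_le_one.2
    fun i hi j hj => by_contra fun hij =>
      disjoint_left.1 (hf hij) (Finset.mem_filter.1 hi).2 (Finset.mem_filter.1 hj).2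
  have hcard_or : {i ∈ S | f i s ≠ 0 ∨ f i t ≠ 0}.card ≤ 2 := by
    rw [Finset.filter_or]
    exact (Finset.card_union_le _ _).trans (add_le_add (hcard s) (hcard t))
  calc ∑ i ∈ S, |f i s - f i t| = ∑ i ∈ S with f i s ≠ 0 ∨ f i t ≠ 0, |f i s - f i t| := by
        refine (Finset.sum_filter_of_ne fun i _ hi => ?_).symm
        contrapose! hi
        rw [hi.1, hi.2, sub_self, abs_zero]
    _ ≤ {i ∈ S | f i s ≠ 0 ∨ f i t ≠ 0}.card • δ := Finset.sum_le_card_nsmul _ _ _ fun i _ => hfδ i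
    _ ≤ 2 • δ := nsmul_le_nsmul_left hδ hcard_or
    _ = 2 * δ := by rw [nsmul_eq_mul, Nat.cast_ofNat]

variable [TopologicalSpace K] {f : ι → C(K, ℝ)}

lemma linearCombination_apply_of_disjoint_support
    (hf : Pairwise (Disjoint on fun i => support (f i))) (a : ι →₀ ℝ) {i : ι} {x : K}
    (hx : f i x ≠ 0) : Finsupp.linearCombination ℝ f a x = a i * f i x := by
  have hzero : ∀ j, j ≠ i → f j x = 0 := fun j hj =>
    notMem_support.1 (disjoint_right.1 (hf hj) hx)
  have happly : Finsupp.linearCombination ℝ f a x = a.sum fun j b => b * f j x := by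
    simp only [Finsupp.linearCombination_apply, Finsupp.sum, ContinuousMap.sum_apply,
      ContinuousMap.smul_apply, smul_eq_mul]
  rw [happly, Finsupp.sum_eq_single i (fun j _ hj => by rw [hzero j hj, mul_zero])
    fun _ => zero_mul _]

lemma linearIndependent_of_disjoint_support
    (hf : Pairwise (Disjoint on fun i => support (f i))) (hf0 : ∀ i, f i ≠ 0) :
    LinearIndependent ℝ f := by
  rw [linearIndependent_iff]
  intro a ha
  ext i
  obtain ⟨x, hx⟩ := DFunLike.ne_iff.1 (hf0 i)
  have h := linearCombination_apply_of_disjoint_support hf a hx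
  rw [ha] at h
  exact (mul_eq_zero.1 h.symm).resolve_right hx

variable [CompactSpace K]

lemma norm_smul_le_norm_linearCombination_of_disjoint_support
    (hf : Pairwise (Disjoint on fun i => support (f i))) (a : ι →₀ ℝ) (i : ι) :
    ‖a i • f i‖ ≤ ‖Finsupp.linearCombination ℝ f a‖ := by
  refine (ContinuousMap.norm_le _ (norm_nonneg _)).2 fun x => ?_
  rw [ContinuousMap.smul_apply, smul_eq_mul]
  by_cases hx : f i x = 0
  · rw [hx, mul_zero, norm_zero]
    exact norm_nonneg _
  · rw [← linearCombination_apply_of_disjoint_support hf a hx]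
    exact ContinuousMap.norm_coe_le_norm _ x

lemma abs_sub_le_of_mem_span_of_disjoint_support (hd : ∀ s t, 0 ≤ d s t)
    (hf : Pairwise (Disjoint on fun i => support (f i)))
    (hlip : ∀ i s t, |f i s - f i t| ≤ d s t) {c : ℝ} (hc : 0 < c) (hcf : ∀ i, c ≤ ‖f i‖)
    {g : C(K, ℝ)} (hg : g ∈ Submodule.span ℝ (range f)) (s t : K) :
    |g s - g t| ≤ 2 * (‖g‖ / c) * d s t := by
  obtain ⟨a, rfl⟩ := Finsupp.mem_span_range_iff_exists_finsupp.1 hg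
  rw [← Finsupp.linearCombination_apply]
  set g := Finsupp.linearCombination ℝ f a
  have hcoef : ∀ i, |a i| ≤ ‖g‖ / c := fun i => by
    rw [le_div_iff₀ hc]
    calc |a i| * c ≤ |a i| * ‖f i‖ := by gcongr; exact hcf i
      _ = ‖a i • f i‖ := by rw [norm_smul, Real.norm_eq_abs]
      _ ≤ ‖g‖ := norm_smul_le_norm_linearCombination_of_disjoint_support hf a i
  have hsub : g s - g t = ∑ i ∈ a.support, a i * (f i s - f i t) := by
    simp only [g, Finsupp.linearCombination_apply, Finsupp.sum, ContinuousMap.sum_apply,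
      ContinuousMap.smul_apply, smul_eq_mul, mul_sub, Finset.sum_sub_distrib]
  calc |g s - g t| ≤ ∑ i ∈ a.support, |a i * (f i s - f i t)| :=
        hsub ▸ Finset.abs_sum_le_sum_abs _ _
    _ ≤ ∑ i ∈ a.support, ‖g‖ / c * |f i s - f i t| := by
        gcongr with i
        rw [abs_mul]
        gcongr
        exact hcoef i
    _ = ‖g‖ / c * ∑ i ∈ a.support, |f i s - f i t| := (Finset.mul_sum _ _ _).symm
    _ ≤ ‖g‖ / c * (2 * d s t) := by
        gcongr
        exact sum_abs_sub_le_of_disjoint_support hf (hd s t) (fun i => hlip i s t) _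
    _ = 2 * (‖g‖ / c) * d s t := by ring

lemma isLipschitzSubspace_closure_span_of_disjoint_support (hd : ∀ s t, 0 ≤ d s t)
    (hf : Pairwise (Disjoint on fun i => support (f i)))
    (hlip : ∀ i s t, |f i s - f i t| ≤ d s t) {c : ℝ} (hc : 0 < c) (hcf : ∀ i, c ≤ ‖f i‖) :
    IsLipschitzSubspace d (Submodule.span ℝ (range f)).topologicalClosure where
  isClosed := Submodule.isClosed_topologicalClosure _
  isLip g hg := by
    refine ⟨2 * (‖g‖ / c), fun s t => ?_⟩
    have hclosed : IsClosed {g : C(K, ℝ) | |g s - g t| ≤ 2 * (‖g‖ / c) * d s t} :=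
      isClosed_le (by fun_prop) (by fun_prop)
    exact closure_minimal (fun g hg =>
      abs_sub_le_of_mem_span_of_disjoint_support hd hf hlip hc hcf hg s t) hclosed hg

end DisjointSupports

section Metrizability

variable {K : Type*} [TopologicalSpace K] {d : K → K → ℝ}

lemma Metrizes.eventually_lt (hm : Metrizes d) (hd : IsMetric d) (x : K) {ε : ℝ} (hε : 0 < ε) :
    ∀ᶠ y in 𝓝 x, d x y < ε := by
  have hopen : IsOpen {y | d x y < ε} := (hm _).2 fun y hy =>
    ⟨ε - d x y, sub_pos.2 hy, fun z hz => (hd.triangle x y z).trans_lt (lt_sub_iff_add_lt'.1 hz)⟩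
  exact hopen.mem_nhds (by rwa [mem_ofPred, hd.self_eq_zero])

lemma IsLscMetric.exists_ball_subset [CompactSpace K] (hd : IsLscMetric d) {U : Set K}
    (hU : IsOpen U) {x : K} (hx : x ∈ U) : ∃ ε > 0, ∀ y, d x y < ε → y ∈ U := by
  rcases Uᶜ.eq_empty_or_nonempty with hempty | hne
  · exact ⟨1, one_pos, fun y _ => compl_empty_iff.1 hempty ▸ mem_univ y⟩
  have hlsc : LowerSemicontinuous (d x) := hd.2.comp (Continuous.prodMk_right x)
  obtain ⟨a, ha, hmin⟩ := (hlsc.lowerSemicontinuousOn Uᶜ).exists_isMinOn hne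
    hU.isClosed_compl.isCompact
  refine ⟨d x a, (hd.1.nonneg x a).lt_of_ne' fun h0 => ?_, fun y hy => ?_⟩
  · exact ha ((hd.1.eq_zero_iff x a).1 h0 ▸ hx)
  · exact not_notMem.1 fun hyU => (hmin hyU).not_gt hy

lemma IsLscMetric.metrizes_iff_eventually_lt [CompactSpace K] (hd : IsLscMetric d) :
    Metrizes d ↔ ∀ x, ∀ ε > 0, ∀ᶠ y in 𝓝 x, d x y < ε := by
  refine ⟨fun hm x ε hε => hm.eventually_lt hd.1 x hε, fun h U =>
    ⟨fun hU x hx => hd.exists_ball_subset hU hx, fun hU => isOpen_iff_mem_nhds.2 fun x hx => ?_⟩⟩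
  obtain ⟨ε, hε, hball⟩ := hU x hx
  exact mem_of_superset (h x ε hε) hball

end Metrizability

section Bumps

variable {K : Type*} [TopologicalSpace K] [CompactSpace K] [T2Space K] {d : K → K → ℝ}

lemma IsLscMetric.exists_seq_peaks (hd : IsLscMetric d) {p : K} {ε r η : ℝ}
    (hfar : ∃ᶠ x in 𝓝 p, ε ≤ d p x) (hr : 0 ≤ r) (hrε : r < ε) (hη : 0 < η) :
    ∃ (F : ℕ → C(K, ℝ)) (x : ℕ → K), (∀ n s t, |F n s - F n t| ≤ d s t) ∧
      (∀ n, F n (x n) = r) ∧ ∀ m n, m < n → F m (x n) < η := by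
  obtain ⟨Fx, hFx, hlt⟩ := exists_seq_of_forall_finset_exists
    (fun a : C(K, ℝ) × K => (∀ s t, |a.1 s - a.1 t| ≤ d s t) ∧ a.1 p = 0 ∧ a.1 a.2 = r)
    (fun a b => a.1 b.2 < η) fun S hS => by
      have hsmall : ∀ᶠ x in 𝓝 p, ∀ a ∈ S, a.1 x < η :=
        (eventually_all_finset S).2 fun a ha =>
          a.1.continuous.continuousAt.eventually_lt_const ((hS a ha).2.1 ▸ hη)
      obtain ⟨x, hxp, hxS⟩ := (hfar.and_eventually hsmall).exists
      obtain ⟨F, hlip, hFp, hFx⟩ := hd.exists_separating (isClosed_singleton (x := p))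
        (isClosed_singleton (x := x)) hr (by rintro _ rfl _ rfl; exact hrε.trans_le hxp)
      exact ⟨(F, x), ⟨hlip, hFp p rfl, hFx x rfl⟩, hxS⟩
  exact ⟨fun n => (Fx n).1, fun n => (Fx n).2, fun n => (hFx n).1, fun n => (hFx n).2.2, hlt⟩

lemma IsLscMetric.exists_seq_disjoint_support (hd : IsLscMetric d) {p : K} {c : ℝ} (hc : 0 < c)
    (hfar : ∃ᶠ x in 𝓝 p, 5 * c ≤ d p x) :
    ∃ f : ℕ → C(K, ℝ), (∀ n s t, |f n s - f n t| ≤ d s t) ∧ (∀ n, c ≤ ‖f n‖) ∧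
      Pairwise (Disjoint on fun n => support (f n)) := by
  obtain ⟨F, x, hF, hFx, hFlt⟩ := hd.exists_seq_peaks hfar (r := 4 * c) (by positivity)
    (by linarith) hc
  -- The `n`-th bump lives where `F n` is above `2 * c` and all earlier `F m` are still below it.
  let Z : ℕ → Set K := fun n => {z | F n z ≤ 2 * c} ∪ ⋃ m ∈ Iio n, {z | 2 * c ≤ F m z}
  have hZclosed : ∀ n, IsClosed (Z n) := fun n =>
    (isClosed_le (by fun_prop) continuous_const).union <| (finite_Iio n).isClosed_biUnion
      fun m _ => isClosed_le continuous_const (by fun_prop)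
  have hZfar : ∀ n, ∀ z ∈ Z n, ∀ y ∈ ({x n} : Set K), c < d z y := by
    rintro n z hz _ rfl
    rcases hz with (hz : F n z ≤ 2 * c) | hz
    · linarith [hFx n, (abs_le.1 (hF n z (x n))).1]
    · obtain ⟨m, hm, hz : 2 * c ≤ F m z⟩ := mem_iUnion₂.1 hz
      linarith [hFlt m n hm, (abs_le.1 (hF m z (x n))).2]
  choose f hlip hfZ hfx using fun n =>
    hd.exists_separating (hZclosed n) isClosed_singleton hc.le (hZfar n)
  refine ⟨f, hlip, fun n => ?_, (pairwise_disjoint_on _).2 fun m n hmn => ?_⟩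
  · calc c = ‖f n (x n)‖ := by rw [hfx n _ rfl, Real.norm_of_nonneg hc.le]
      _ ≤ ‖f n‖ := (f n).norm_coe_le_norm _
  · refine disjoint_left.2 fun z hzm hzn => ?_
    rcases le_total (F m z) (2 * c) with h | h
    · exact hzm (hfZ m z (Or.inl h))
    · exact hzn (hfZ n z (Or.inr (mem_biUnion (mem_Iio.2 hmn) h)))

theorem IsLscMetric.exists_isLipschitzSubspace_not_finiteDimensional (hd : IsLscMetric d)
    (hm : ¬ Metrizes d) :
    ∃ X : Submodule ℝ C(K, ℝ), IsLipschitzSubspace d X ∧ ¬ FiniteDimensional ℝ X := by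
  rw [hd.metrizes_iff_eventually_lt] at hm
  push Not at hm
  obtain ⟨p, ε, hε, hfar⟩ := hm
  obtain ⟨f, hlip, hnorm, hdisj⟩ := hd.exists_seq_disjoint_support (c := ε / 5) (p := p)
    (by positivity) (by rwa [mul_div_cancel₀ _ (by norm_num)])
  refine ⟨_, isLipschitzSubspace_closure_span_of_disjoint_support hd.1.nonneg hdisj hlip
    (by positivity) hnorm, fun hfin => ?_⟩
  have hne : ∀ n, f n ≠ 0 := fun n =>
    norm_pos_iff.1 ((by positivity : 0 < ε / 5).trans_le (hnorm n))
  have : FiniteDimensional ℝ (Submodule.span ℝ (range f)) :=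
    Submodule.finiteDimensional_of_le (Submodule.le_topologicalClosure _)
  exact Module.Finite.not_linearIndependent_of_infinite _
    (linearIndependent_span (linearIndependent_of_disjoint_support hdisj hne))

end Bumps

section FiniteDimensional

lemma exists_norm_le_mul_of_isClosed_of_pointwise {𝕜 E F ι : Type*} [NontriviallyNormedField 𝕜]
    [SeminormedAddCommGroup E] [NormedSpace 𝕜 E] [CompleteSpace E] [SeminormedAddCommGroup F]
    [NormedSpace 𝕜 F] {X : Submodule 𝕜 E} (hX : IsClosed (X : Set E)) {g : ι → E →L[𝕜] F}
    (hg : ∀ x ∈ X, ∃ C, ∀ i, ‖g i x‖ ≤ C) : ∃ C, ∀ x ∈ X, ∀ i, ‖g i x‖ ≤ C * ‖x‖ := by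
  have : CompleteSpace X := hX.completeSpace_coe
  obtain ⟨C, hC⟩ := banach_steinhaus (g := fun i => g i ∘L X.subtypeL) fun x => hg x x.2
  exact ⟨C, fun x hx i => (g i ∘L X.subtypeL).le_of_opNorm_le (hC i) ⟨x, hx⟩⟩

variable {K : Type*} [TopologicalSpace K] [CompactSpace K] {d : K → K → ℝ}

theorem IsLipschitzSubspace.exists_abs_sub_le {X : Submodule ℝ C(K, ℝ)}
    (hX : IsLipschitzSubspace d X) (hd : IsMetric d) :
    ∃ C, ∀ f ∈ X, ∀ s t, |f s - f t| ≤ C * ‖f‖ * d s t := by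
  let φ : K × K → C(K, ℝ) →L[ℝ] ℝ := fun z =>
    (d z.1 z.2)⁻¹ • (ContinuousMap.evalCLM ℝ z.1 - ContinuousMap.evalCLM ℝ z.2)
  have hφ : ∀ z f, ‖φ z f‖ = |f z.1 - f z.2| / d z.1 z.2 := fun z f => by
    change ‖(d z.1 z.2)⁻¹ * (f z.1 - f z.2)‖ = _
    rw [norm_mul, norm_inv, Real.norm_of_nonneg (hd.nonneg _ _), inv_mul_eq_div, Real.norm_eq_abs]
  have hbounded : ∀ f ∈ X, ∃ C, ∀ z, ‖φ z f‖ ≤ C := fun f hf => by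
    obtain ⟨C, hC⟩ := hX.isLip f hf
    refine ⟨|C|, fun z => ?_⟩
    have hz := hd.nonneg z.1 z.2
    rw [hφ]
    refine div_le_of_le_mul₀ hz (abs_nonneg C) ((hC z.1 z.2).trans ?_)
    gcongr
    exact le_abs_self C
  obtain ⟨C, hC⟩ := exists_norm_le_mul_of_isClosed_of_pointwise hX.isClosed hbounded
  refine ⟨C, fun f hf s t => ?_⟩
  rcases eq_or_ne s t with rfl | hst
  · simp [hd.self_eq_zero]
  have hpos : 0 < d s t := (hd.nonneg s t).lt_of_ne' (mt (hd.eq_zero_iff s t).1 hst)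
  exact (div_le_iff₀ hpos).1 (hφ (s, t) f ▸ hC f hf (s, t))

lemma finiteDimensional_of_equicontinuous_closedBall {X : Submodule ℝ C(K, ℝ)}
    (hX : Equicontinuous fun (f : Metric.closedBall (0 : X) 1) (x : K) => f.1.1 x) :
    FiniteDimensional ℝ X := by
  let φ : X → BoundedContinuousFunction K ℝ := fun f => BoundedContinuousFunction.mkOfCompact f.1
  have hφ : Isometry φ :=
    (ContinuousMap.isometryEquivBoundedOfCompact K ℝ).isometry.comp isometry_subtype_coe
  have hcompact : IsCompact (closure (φ '' Metric.closedBall 0 1)) := by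
    refine BoundedContinuousFunction.arzela_ascoli (Metric.closedBall 0 1)
      (isCompact_closedBall _ _) _ ?_ ?_
    · rintro _ x ⟨f, hf, rfl⟩
      rw [mem_closedBall_zero_iff] at hf ⊢
      exact (f.1.norm_coe_le_norm x).trans hf
    · exact fun x U hU => (hX x U hU).mono fun y hy => by
        rintro ⟨_, f, hf, rfl⟩
        exact hy ⟨f, hf⟩
  exact .of_totallyBounded_nhds_zero ℝ (Metric.closedBall_mem_nhds 0 one_pos) <|
    (totallyBounded_image_iff hφ.isUniformInducing).1
      (hcompact.totallyBounded.subset subset_closure)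

theorem Metrizes.finiteDimensional (hm : Metrizes d) (hd : IsMetric d) {X : Submodule ℝ C(K, ℝ)}
    (hX : IsLipschitzSubspace d X) : FiniteDimensional ℝ X := by
  obtain ⟨C, hC⟩ := hX.exists_abs_sub_le hd
  refine finiteDimensional_of_equicontinuous_closedBall fun x =>
    Metric.equicontinuousAt_iff_right.2 fun ε hε => ?_
  filter_upwards [hm.eventually_lt hd x (div_pos hε (by positivity : 0 < |C| + 1))] with y hy f
  have hf : ‖f.1.1‖ ≤ 1 := mem_closedBall_zero_iff.1 f.2
  calc |f.1.1 x - f.1.1 y| ≤ C * ‖f.1.1‖ * d x y := hC f.1.1 f.1.2 x y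
    _ ≤ (|C| + 1) * 1 * d x y := by
        gcongr
        · exact hd.nonneg x y
        · linarith [le_abs_self C]
    _ < ε := by rwa [mul_one, ← lt_div_iff₀' (by positivity)]

end FiniteDimensional

end LipSubspace

theorem corollary4p3 {K : Type*} [TopologicalSpace K] [CompactSpace K] [T2Space K]
    (d : K → K → ℝ) (hd : LipSubspace.IsLscMetric d) :
    (LipSubspace.Metrizes d ↔
      ∀ X : Submodule ℝ C(K, ℝ), LipSubspace.IsLipschitzSubspace d X → FiniteDimensional ℝ X) ∧
    (LipSubspace.IsSpaceable (LipSubspace.lipC d) ↔ ¬ LipSubspace.Metrizes d) := by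
  refine ⟨⟨fun hm X hX => hm.finiteDimensional hd.1 hX, fun h => ?_⟩, ?_, fun hm => ?_⟩
  · by_contra hm
    obtain ⟨X, hX, hinf⟩ := hd.exists_isLipschitzSubspace_not_finiteDimensional hm
    exact hinf (h X hX)
  · rintro ⟨X, hle, hclosed, hinf⟩ hm
    exact hinf (hm.finiteDimensional hd.1 ⟨hclosed, fun f hf => hle hf⟩)
  · obtain ⟨X, hX, hinf⟩ := hd.exists_isLipschitzSubspace_not_finiteDimensional hm
    exact ⟨X, fun f hf => hX.isLip f hf, hX.isClosed, hinf⟩
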